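/- For a regular uncountable cardinal $\lambda$, let $I[\lambda]$ be the family of all $A\subseteq\lambda$ such that $\{\delta\in A:\delta=\mathrm{cf}(\delta)\}$ is not stationary in $\lambda$ and there is a sequence $\langle\mathcal P_\alpha:\alpha<\lambda\rangle$ with the following two properties: (a) each $\mathcal P_\alpha$ is a family of fewer than $\lambda$ subsets of $\alpha$; (b) for every limit ordinal $\alpha\in A$ with $\mathrm{cf}(\alpha)<\alpha$ there is $x\subseteq\alpha$ with $\mathrm{otp}(x)<\alpha=\sup(x)$ such that $x\cap\zeta\in\bigcup_{\gamma<\alpha}\mathcal P_\gamma$ for every $\zeta<\alpha$. Theorem. Let $\kappa$ and $\lambda$ be regular (infinite) cardinals with $\kappa^+<\lambda$. Then there is a set $S\subseteq\{\delta<\lambda:\mathrm{cf}(\delta)=\kappa\}$ which is stationary in $\lambda$ and belongs to $I[\lambda]$. -/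

import Mathlib

universe u

/-- The order type of a set of ordinals (in the next universe, where sets of ordinals live). -/
noncomputable def orderTypeOf (x : Set Ordinal.{u}) : Ordinal.{u + 1} :=
  Ordinal.type (fun a b : x => a < b)

/-- A set `A` of ordinals is stationary in the ordinal `o`: its trace on `o = {a | a < o}`
meets every closed unbounded subset of `o`. -/
def StationaryIn (o : Ordinal.{u}) (A : Set Ordinal.{u}) : Prop :=
  IsStationary {a : Set.Iio o | (a : Ordinal.{u}) ∈ A}

/-- Shelah's ideal `I[lam]` (for `lam` a regular uncountable cardinal): the family of all
`A ⊆ lam` such that `{δ ∈ A | δ = cf δ}` is not stationary in `lam`, and for some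
`⟨P α | α < lam⟩`:
* every `P α` is a family of fewer than `lam` subsets of `α`;
* for every limit `α ∈ A` with `cf α < α` there is `x ⊆ α` with `otp x < α = sup x`
  all of whose proper initial segments `x ∩ ζ`, `ζ < α`, belong to `⋃ γ < α, P γ`. -/
def approachabilityIdeal (lam : Cardinal.{u}) : Set (Set Ordinal.{u}) :=
  {A | A ⊆ Set.Iio lam.ord ∧
    ¬ StationaryIn lam.ord {δ | δ ∈ A ∧ δ = δ.cof.ord} ∧
    ∃ P : Ordinal.{u} → Set (Set Ordinal.{u}),
      (∀ α < lam.ord, Cardinal.mk (P α) < Cardinal.lift.{u + 1} lam ∧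
        ∀ y ∈ P α, y ⊆ Set.Iio α) ∧
      ∀ α ∈ A, Order.IsSuccLimit α → α.cof.ord < α →
        ∃ x : Set Ordinal.{u}, x ⊆ Set.Iio α ∧
          orderTypeOf x < Ordinal.lift.{u + 1} α ∧ IsLUB x α ∧
          ∀ ζ < α, ∃ γ < α, x ∩ Set.Iio ζ ∈ P γ}

/-!
A stationary set lies in `I[lam]` once its points `δ` are approachable along one sequence `P`, i.e.
`δ` has a small cofinal subset whose initial segments are all listed in `P` before stage `δ`.

If `lam` is the successor of a regular `μ > κ`, inject every `d < lam` into `μ` by `g d`, and let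
`P` list the sublevel sets of the `g d`. For `d` of cofinality `κ`, closing `i < μ` under suitable
functions makes the `i`-th sublevel set of `g d` agree below each of its own members `b` with that
of `g b`, while for large `i` it is cofinal in `d`. So every point of cofinality `κ` is
approachable.

Otherwise there is a regular `σ` with `κ⁺ < σ < lam`, and `σ` carries a sequence `C` guessing clubs
at points of cofinality `κ`. Two continuous cofinal maps from `σ` into the same ordinal agree on a
club. Fix such a map `e d` for every `d` of cofinality `σ`, and let `P` list the images under `e d`
of the initial segments of the `C a`. Build `f` normal from `σ` into a given club so fast that `f j`
exceeds, for every `C a` and `i < j`, a stage listing the image under `f` of the initial segment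
`C a ∩ Iio i` if there is one. With `d` the supremum of `f`, some `C a` lies in the club where `f`
and `e d` agree, and so the image of `C a` shows that `f a` is approachable.
-/

open Cardinal Order Set

universe v w

section WellOrder

variable {α : Type u} {β : Type v} [LinearOrder α] [LinearOrder β]

theorem exists_forall_lt_of_lift_mk_lt_lift_cof {ι : Type w} (f : ι → β)
    (hι : lift.{v} #ι < lift.{w} (cof β)) : ∃ b, ∀ i, f i < b := by
  have hf : ¬ IsCofinal (range f) := fun hf ↦
    (mk_range_le_lift.trans_lt hι).not_ge (lift_le.2 (cof_le hf))
  simpa using not_isCofinal_iff.1 hf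

theorem nonempty_of_aleph0_le_cof (hβ : ℵ₀ ≤ cof β) : Nonempty β :=
  cof_ne_zero_iff.1 (aleph0_pos.trans_le hβ).ne'

theorem noMaxOrder_of_aleph0_le_cof (hβ : ℵ₀ ≤ cof β) : NoMaxOrder β := by
  have := nonempty_of_aleph0_le_cof hβ
  exact (noTopOrder_iff_noMaxOrder β).1 (one_lt_cof_iff.1 (one_lt_aleph0.trans_le hβ))

theorem lift_cof_Iio_of_isLUB_range [NoMaxOrder α] {f : α → β} (hf : StrictMono f) {d : β}
    (hd : IsLUB (range f) d) : lift.{u} (cof (Iio d)) = lift.{v} (cof α) := by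
  have hfd (i : α) : f i < d := (exists_gt i).elim fun j hij ↦ (hf hij).trans_le (hd.1 ⟨j, rfl⟩)
  refine (lift_cof_congr_of_strictMono (f := fun i ↦ (⟨f i, hfd i⟩ : Iio d)) hf ?_).symm
  rintro ⟨b, hb⟩
  obtain ⟨_, ⟨i, rfl⟩, hi⟩ := (lt_isLUB_iff hd).1 hb
  exact ⟨_, ⟨i, rfl⟩, hi.le⟩

theorem isClub_Ioi [NoMaxOrder β] (b : β) : IsClub (Ioi b) where
  dirSupClosed := (isUpperSet_Ioi b).dirSupClosed
  isCofinal c := (exists_gt (max b c)).imp fun _ h ↦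
    ⟨(le_max_left b c).trans_lt h, ((le_max_right b c).trans_lt h).le⟩

variable [WellFoundedLT α] [WellFoundedLT β]

theorem exists_isLeast_of_nonempty {s : Set β} (hs : s.Nonempty) : ∃ b, IsLeast s b :=
  (exists_minimal_of_wellFoundedLT (· ∈ s) hs).imp fun _ ↦ minimal_iff_isLeast.1

theorem exists_isLUB_of_bddAbove {s : Set β} (hs : BddAbove s) : ∃ b, IsLUB s b :=
  exists_isLeast_of_nonempty hs

theorem exists_isNormal_forall_mem_and_lt {E : Set β} (hE : IsClub E)
    (hα : ∀ i : α, lift.{v} #(Iio i) < lift.{u} (cof β)) (G : ∀ i : α, (Iio i → β) → β) :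
    ∃ f : α → β, IsNormal f ∧ (∀ i, f i ∈ E) ∧
      ∀ i j, i < j → G i (fun k ↦ f k) < f j := by
  have hnext (j : α) (r : Iio j → β) : ∃ b, IsLeast
      {b | b ∈ E ∧ ∀ i : Iio j, r i < b ∧ G i (fun k ↦ r ⟨k, k.2.trans i.2⟩) < b} b := by
    obtain ⟨b, hb⟩ := exists_forall_lt_of_lift_mk_lt_lift_cof
      (fun i : Iio j ↦ max (r i) (G i (fun k ↦ r ⟨k, k.2.trans i.2⟩))) (hα j)
    obtain ⟨c, hcE, hbc⟩ := hE.isCofinal b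
    exact exists_isLeast_of_nonempty ⟨c, hcE, fun i ↦ max_lt_iff.1 ((hb i).trans_le hbc)⟩
  choose next hnext using hnext
  let f : α → β := wellFounded_lt.fix fun j r ↦ next j fun i ↦ r i i.2
  have hf (j : α) :
      IsLeast {b | b ∈ E ∧ ∀ i : Iio j, f i < b ∧ G i (fun k ↦ f k) < b} (f j) := by
    rw [show f j = next j fun i ↦ f i from wellFounded_lt.fix_eq _ j]
    exact hnext j _
  have hmono : StrictMono f := fun i j hij ↦ ((hf j).1.2 ⟨i, hij⟩).1
  refine ⟨f, isNormal_iff.2 ⟨hmono, fun j hj b hb ↦ ?_⟩, fun j ↦ (hf j).1.1,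
    fun i j hij ↦ ((hf j).1.2 ⟨i, hij⟩).2⟩
  have hbdd : b ∈ upperBounds (f '' Iio j) := by simpa [mem_upperBounds] using hb
  obtain ⟨l, hl⟩ := exists_isLUB_of_bddAbove ⟨b, hbdd⟩
  refine ((hf j).2 ⟨hE.isLUB_mem ?_ (hj.nonempty_Iio.image f) hl, fun i ↦ ?_⟩).trans (hl.2 hbdd)
  · rintro _ ⟨i, -, rfl⟩
    exact (hf i).1.1
  · obtain ⟨k, hik, hkj⟩ := hj.lt_iff_exists_lt.1 i.2
    have hkl : f k ≤ l := hl.1 ⟨k, hik, rfl⟩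
    exact ⟨(hmono hkj).trans_le hkl, ((hf k).1.2 ⟨i, hkj⟩).2.trans_le hkl⟩

theorem exists_isNormal_forall_mem_and_image_lt {E : Set β} (hE : IsClub E)
    (hα : lift.{v} #α < lift.{u} (cof β)) (C : α → Set α) (F : Set β → β) :
    ∃ f : α → β, IsNormal f ∧ (∀ i, f i ∈ E) ∧
      ∀ a i j, i < j → F (f '' (C a ∩ Iio i)) < f j := by
  choose bound hbound using fun g : α → β ↦ exists_forall_lt_of_lift_mk_lt_lift_cof g hα
  obtain ⟨f, hf, hfE, hlt⟩ := exists_isNormal_forall_mem_and_lt hE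
    (fun i : α ↦ (lift_le.2 (mk_set_le (Iio i))).trans_lt hα)
    fun i r ↦ bound fun a ↦ F (r '' (Subtype.val ⁻¹' C a))
  refine ⟨f, hf, hfE, fun a i j hij ↦ lt_trans ?_ (hlt i j hij)⟩
  have himage : (fun k : Iio i ↦ f k) '' (Subtype.val ⁻¹' C a) = f '' (C a ∩ Iio i) := by
    rw [← Function.comp_def f, image_comp, Subtype.image_preimage_coe, inter_comm]
  exact himage ▸ hbound (fun a ↦ F ((fun k : Iio i ↦ f k) '' (Subtype.val ⁻¹' C a))) a

end WellOrder

section RegularCardinalOrder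

variable {α : Type u} [LinearOrder α] [WellFoundedLT α] [IsRegularCardinalOrder α]

theorem mk_Iio_lt_cof (i : α) : #(Iio i) < cof α :=
  cof_eq_cardinalMk (α := α) ▸ mk_Iio_lt i ord_cardinalMk

theorem isClub_setOf_forall_lt_apply_lt (hα : ℵ₀ < cof α) (F : α → α) :
    IsClub {i | ∀ j < i, F j < i} where
  dirSupClosed s hs _ _ i hi j hj := by
    obtain ⟨k, hk, hjk⟩ := (lt_isLUB_iff hi).1 hj
    exact (hs hk j hjk).trans_le (hi.1 hk)
  isCofinal := by
    obtain ⟨f, hf, -, hFf⟩ := exists_isNormal_forall_mem_and_lt (IsClub.univ (α := α))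
      (fun i : α ↦ lift_lt.2 (mk_Iio_lt_cof i)) (fun j _ ↦ F j)
    refine (hf.isClub_fixedPoints hα.ne').isCofinal.mono fun i (hi : f i = i) j hj ↦ ?_
    exact (hFf j i hj).trans_eq hi

theorem isClub_setOf_forall_lt_forall_lt_apply_lt (hα : ℵ₀ < cof α) (F : α → α → α) :
    IsClub {i | ∀ j < i, ∀ k < i, F j k < i} where
  dirSupClosed s hs _ _ i hi j hj k hk := by
    obtain ⟨l, hl, hjkl⟩ := (lt_isLUB_iff hi).1 (max_lt hj hk)
    exact (hs hl j ((le_max_left j k).trans_lt hjkl) k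
      ((le_max_right j k).trans_lt hjkl)).trans_le (hi.1 hl)
  isCofinal := by
    have hbound (b : α) : ∃ c, ∀ p : Iio b × Iio b, F p.1 p.2 < c := by
      refine exists_forall_lt_of_lift_mk_lt_lift_cof (fun p : Iio b × Iio b ↦ F p.1 p.2) ?_
      simpa using mul_lt_of_lt hα.le (mk_Iio_lt_cof b) (mk_Iio_lt_cof b)
    choose bound hbound using hbound
    have := noMaxOrder_of_aleph0_le_cof hα.le
    choose above habove using exists_gt (α := α)
    have hclub := isClub_setOf_forall_lt_apply_lt hα fun j ↦ max (above j) (bound (above j))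
    refine hclub.isCofinal.mono fun i hi j hj k hk ↦ ?_
    have hjk := hi (max j k) (max_lt hj hk)
    have hlt := habove (max j k)
    refine (hbound _ (⟨j, ?_⟩, ⟨k, ?_⟩)).trans ((le_max_right _ _).trans_lt hjk)
    · exact (le_max_left j k).trans_lt hlt
    · exact (le_max_right j k).trans_lt hlt

theorem isClub_setOf_isSuccLimit (hα : ℵ₀ < cof α) : IsClub {i : α | IsSuccLimit i} where
  dirSupClosed s hs hs₀ _ i hi := by
    by_cases his : i ∈ s
    · exact hs his
    · exact hi.isSuccLimit_of_notMem hs₀ his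
  isCofinal := by
    have := noMaxOrder_of_aleph0_le_cof hα.le
    obtain ⟨a⟩ := nonempty_of_aleph0_le_cof hα.le
    choose above habove using exists_gt (α := α)
    have hclub := (isClub_setOf_forall_lt_apply_lt hα above).inter hα.ne' (isClub_Ioi a)
    refine hclub.isCofinal.mono fun i hi ↦ ⟨not_isMin_iff.2 ⟨a, hi.2⟩, fun j hj ↦ ?_⟩
    exact hj.2 (habove j) (hi.1 j hj.1)

theorem exists_isClub_forall_apply_le {β : Type v} [LinearOrder β] (hα : ℵ₀ < cof α)
    {f g : α → β} (hf : IsNormal f) (hg : StrictMono g) {d : β} (hfd : d ∈ upperBounds (range f))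
    (hgd : IsLUB (range g) d) : ∃ D : Set α, IsClub D ∧ ∀ i ∈ D, f i ≤ g i := by
  have := noMaxOrder_of_aleph0_le_cof hα.le
  have hup (j : α) : ∃ k, f j < g k := by
    obtain ⟨k, hjk⟩ := exists_gt j
    simpa using (lt_isLUB_iff hgd).1 ((hf.strictMono hjk).trans_le (hfd ⟨k, rfl⟩))
  choose up hup using hup
  refine ⟨_, (isClub_setOf_forall_lt_apply_lt hα up).inter hα.ne' (isClub_setOf_isSuccLimit hα),
    fun i hi ↦ (hf.le_iff_forall_le hi.2).2 fun j hj ↦ ?_⟩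
  exact (hup j).le.trans (hg (hi.1 j hj)).le

theorem exists_isClub_eqOn_of_isLUB_range {β : Type v} [LinearOrder β] (hα : ℵ₀ < cof α)
    {f g : α → β} (hf : IsNormal f) (hg : IsNormal g) {d : β} (hfd : IsLUB (range f) d)
    (hgd : IsLUB (range g) d) : ∃ D : Set α, IsClub D ∧ EqOn f g D := by
  obtain ⟨D, hD, hfg⟩ := exists_isClub_forall_apply_le hα hf hg.strictMono hfd.1 hgd
  obtain ⟨D', hD', hgf⟩ := exists_isClub_forall_apply_le hα hg hf.strictMono hgd.1 hfd
  exact ⟨D ∩ D', hD.inter hα.ne' hD', fun i hi ↦ (hfg i hi.1).antisymm (hgf i hi.2)⟩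

end RegularCardinalOrder

theorem cof_toType_ord {c : Cardinal.{u}} (hc : c.IsRegular) : cof c.ord.ToType = c := by
  rw [Ordinal.cof_toType, hc.cof_ord]

theorem isRegularCardinalOrder_toType_ord {c : Cardinal.{u}} (hc : c.IsRegular) :
    IsRegularCardinalOrder c.ord.ToType where
  type_lt_le_ord_cof := by rw [cof_toType_ord hc, Ordinal.type_toType]

theorem exists_lift_cof_Iio_eq_and_isLUB_inter {β : Type v} [LinearOrder β] [WellFoundedLT β]
    {κ : Cardinal.{u}} (hκ : κ.IsRegular) {E : Set β} (hE : IsClub E)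
    (hκβ : lift.{v} κ < lift.{u} (cof β)) :
    ∃ d ∈ E, lift.{u} (cof (Iio d)) = lift.{v} κ ∧ IsLUB (E ∩ Iio d) d := by
  have hκ₀ := hκ.aleph0_le.trans_eq (cof_toType_ord hκ).symm
  have := nonempty_of_aleph0_le_cof hκ₀
  have := noMaxOrder_of_aleph0_le_cof hκ₀
  have hcard : lift.{v} #κ.ord.ToType < lift.{u} (cof β) := by rwa [mk_ord_toType]
  obtain ⟨b₀⟩ : Nonempty β := cof_ne_zero_iff.1 fun h ↦ by simp [h] at hκβ
  obtain ⟨f, hf, hfE, -⟩ := exists_isNormal_forall_mem_and_lt hE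
    (fun i : κ.ord.ToType ↦ (lift_le.2 (mk_set_le (Iio i))).trans_lt hcard) fun _ _ ↦ b₀
  obtain ⟨b, hb⟩ := exists_forall_lt_of_lift_mk_lt_lift_cof f hcard
  obtain ⟨d, hd⟩ := exists_isLUB_of_bddAbove ⟨b, forall_mem_range.2 fun i ↦ (hb i).le⟩
  refine ⟨d, hE.isLUB_mem (range_subset_iff.2 hfE) (range_nonempty f) hd, ?_,
    fun c hc ↦ hc.2.le, fun c hc ↦ hd.2 (forall_mem_range.2 fun i ↦ ?_)⟩
  · rw [lift_cof_Iio_of_isLUB_range hf.strictMono hd, cof_toType_ord hκ]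
  · obtain ⟨j, hij⟩ := exists_gt i
    exact hc ⟨hfE i, (hf.strictMono hij).trans_le (hd.1 ⟨j, rfl⟩)⟩

section ClubGuessing

variable {α : Type u} [LinearOrder α]

/-- The set obtained by gluing `e` to `E`, in which each point of `e` is replaced by the largest
point of `E` below it. The points of `e` with no such point of `E` are dropped. -/
def clubGlue (E e : Set α) : Set α :=
  {b | ∃ x ∈ e, IsGreatest (E ∩ Iic x) b}

/-- A sequence guessing the clubs of `α` at points of cofinality `κ`. For every club `D`, at some
point `a` of cofinality `κ` the guess `C a` is an unbounded subset of `a` with at most `κ` elements,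
all of them in `D`. -/
def IsClubGuessing (κ : Cardinal.{u}) (C : α → Set α) : Prop :=
  ∀ D : Set α, IsClub D →
    ∃ a, cof (Iio a) = κ ∧ C a ⊆ D ∩ Iio a ∧ IsLUB (C a) a ∧ #(C a) ≤ κ

theorem mk_clubGlue_le (E e : Set α) : #(clubGlue E e) ≤ #e := by
  choose x hx hgreatest using fun b : clubGlue E e ↦ b.2
  refine mk_le_of_injective (f := fun b ↦ (⟨x b, hx b⟩ : e)) fun b c hbc ↦ Subtype.ext ?_
  have hbc : x b = x c := congrArg Subtype.val hbc
  exact (hgreatest b).unique (hbc ▸ hgreatest c)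

theorem clubGlue_subset_Iio {E e : Set α} {a : α} (he : e ⊆ Iio a) : clubGlue E e ⊆ Iio a :=
  fun _ ⟨_, hx, hb⟩ ↦ hb.1.2.trans_lt (he hx)

theorem exists_subset_Iio_mk_eq_cof_Iio (a : α) :
    ∃ e ⊆ Iio a, #e = cof (Iio a) ∧ ∀ b < a, ∃ x ∈ e, b ≤ x := by
  obtain ⟨e, he, hecard⟩ := exists_cof_eq (Iio a)
  refine ⟨(↑) '' e, by simp, by rw [mk_image_eq Subtype.val_injective, hecard], fun b hb ↦ ?_⟩
  obtain ⟨x, hx, hbx⟩ := he ⟨b, hb⟩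
  exact ⟨x, mem_image_of_mem _ hx, hbx⟩

variable [WellFoundedLT α]

theorem exists_isGreatest_inter_Iic {E : Set α} (hE : DirSupClosed E) {x : α}
    (hx : (E ∩ Iic x).Nonempty) : ∃ b, IsGreatest (E ∩ Iic x) b := by
  obtain ⟨b, hb⟩ := exists_isLUB_of_bddAbove (s := E ∩ Iic x) ⟨x, fun y hy ↦ hy.2⟩
  exact ⟨b, ⟨hE inter_subset_left hx (.of_linearOrder _) hb, hb.2 fun y hy ↦ hy.2⟩, hb.1⟩

theorem isLUB_clubGlue {E e : Set α} {a : α} (hE : DirSupClosed E) (ha : IsLUB (E ∩ Iio a) a)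
    (hea : e ⊆ Iio a) (he : ∀ b < a, ∃ x ∈ e, b ≤ x) : IsLUB (clubGlue E e) a := by
  refine ⟨fun b hb ↦ (clubGlue_subset_Iio hea hb).le, fun c hc ↦ le_of_not_gt fun hca ↦ ?_⟩
  obtain ⟨y, ⟨hyE, hya⟩, hcy⟩ := (lt_isLUB_iff ha).1 hca
  obtain ⟨x, hx, hyx⟩ := he y hya
  obtain ⟨b, hb⟩ := exists_isGreatest_inter_Iic hE ⟨y, hyE, hyx⟩
  exact (hcy.trans_le (hb.2 ⟨hyE, hyx⟩)).not_ge (hc ⟨x, hx, hb⟩)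

theorem exists_forall_ge_isGreatest_inter_Iic_mem_iInter {ι : Type*} [LinearOrder ι] [Nonempty ι]
    {E : ι → Set α} (hE : Antitone E) (hclosed : ∀ i, DirSupClosed (E i)) (x : α) :
    ∃ i₀, ∀ i ≥ i₀, ∀ b, IsGreatest (E i ∩ Iic x) b → b ∈ ⋂ j, E j := by
  by_cases hne : ∀ i, (E i ∩ Iic x).Nonempty
  swap
  · obtain ⟨k, hk⟩ := not_forall.1 hne
    exact ⟨k, fun i hki b hb ↦ (hk ⟨b, hE hki hb.1.1, hb.1.2⟩).elim⟩
  -- The greatest points `top i` decrease with `i`, so by well-foundedness they stabilize.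
  choose top htop using fun i ↦ exists_isGreatest_inter_Iic (hclosed i) (hne i)
  have htop_anti : Antitone top := fun i j hij ↦
    (htop j).mono (htop i) (inter_subset_inter_left _ (hE hij))
  obtain ⟨_, ⟨i₀, rfl⟩, hi₀⟩ := exists_isLeast_of_nonempty (range_nonempty top)
  have htop_eq {k} (hk : i₀ ≤ k) : top k = top i₀ := (htop_anti hk).antisymm (hi₀ ⟨k, rfl⟩)
  refine ⟨i₀, fun i hi b hb ↦ mem_iInter.2 fun j ↦ hE (le_max_right i j) ?_⟩
  rw [hb.unique (htop i), htop_eq hi, ← htop_eq (hi.trans (le_max_left i j))]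
  exact (htop _).1.1

theorem exists_clubGlue_subset_iInter {ι : Type u} [LinearOrder ι] {E : ι → Set α}
    (hE : Antitone E) (hclosed : ∀ i, DirSupClosed (E i)) {e : Set α} (he : #e < cof ι) :
    ∃ i, clubGlue (E i) e ⊆ ⋂ j, E j := by
  have : Nonempty ι := cof_ne_zero_iff.1 he.ne_bot
  choose stable hstable using exists_forall_ge_isGreatest_inter_Iic_mem_iInter hE hclosed
  obtain ⟨i, hi⟩ := exists_forall_lt_of_lift_mk_lt_lift_cof (fun x : e ↦ stable x) (lift_lt.2 he)
  exact ⟨i, fun b ⟨x, hx, hb⟩ ↦ hstable x i (hi ⟨x, hx⟩).le b hb⟩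

theorem exists_antitone_isClub_forall_subset {ι : Type u} [LinearOrder ι] [WellFoundedLT ι]
    (hα : cof α ≠ ℵ₀) (hι : ∀ i : ι, #(Iio i) < cof α) (D : Set α → Set α)
    (hD : ∀ E, IsClub (D E)) :
    ∃ E : ι → Set α, Antitone E ∧ (∀ i, IsClub (E i)) ∧ ∀ i j, i < j → E j ⊆ D (E i) := by
  let E : ι → Set α := wellFounded_lt.fix fun i r ↦ ⋂ j : Iio i, D (r j j.2)
  have hE (i : ι) : E i = ⋂ j : Iio i, D (E j) := wellFounded_lt.fix_eq _ i
  refine ⟨E, fun i k hik ↦ ?_, fun i ↦ ?_, fun i j hij ↦ ?_⟩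
  · rw [hE i, hE k]
    exact subset_iInter fun j ↦ iInter_subset_of_subset ⟨j, j.2.trans_le hik⟩ subset_rfl
  · rw [hE i]
    exact .iInter hα (lift_lt.2 (hι i)) fun j ↦ hD _
  · rw [hE j]
    exact iInter_subset _ (⟨i, hij⟩ : Iio j)

theorem exists_isClubGuessing {κ : Cardinal.{u}} (hκ : κ.IsRegular) (hα : succ κ < cof α) :
    ∃ C : α → Set α, IsClubGuessing κ C := by
  have hcof := (hκ.aleph0_le.trans_lt (lt_succ κ)).trans hα
  by_contra! hno
  choose e hea hecard he using exists_subset_Iio_mk_eq_cof_Iio (α := α)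
  simp only [IsClubGuessing, not_forall] at hno
  choose D hD hnot using fun E : Set α ↦ hno fun a ↦ clubGlue E (e a)
  -- A club `D E` defeats the guesses glued to `E`. Along `κ⁺` rounds of intersecting with the
  -- `D E`, the glued set at a point of cofinality `κ` stabilizes inside all of the clubs.
  let ι := (succ κ).ord.ToType
  have hsucc := isRegular_succ hκ.aleph0_le
  have hι : cof ι = succ κ := cof_toType_ord hsucc
  have : IsRegularCardinalOrder ι := isRegularCardinalOrder_toType_ord hsucc
  have := noMaxOrder_of_aleph0_le_cof (hι.symm ▸ hsucc.aleph0_le : ℵ₀ ≤ cof ι)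
  obtain ⟨E, hanti, hclub, hED⟩ := exists_antitone_isClub_forall_subset (ι := ι) hcof.ne'
    (fun i ↦ ((mk_Iio_lt_cof i).trans_eq hι).trans hα) D hD
  obtain ⟨a, ha, haE⟩ : ∃ a, cof (Iio a) = κ ∧ IsLUB ((⋂ i, E i) ∩ Iio a) a := by
    have hE : IsClub (⋂ i, E i) := .iInter hcof.ne' (by simpa [ι] using hα) hclub
    obtain ⟨a, -, ha⟩ := exists_lift_cof_Iio_eq_and_isLUB_inter hκ hE
      (lift_lt.2 ((lt_succ κ).trans hα))
    exact ⟨a, by simpa using ha⟩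
  obtain ⟨i, hi⟩ := exists_clubGlue_subset_iInter hanti (fun i ↦ (hclub i).dirSupClosed)
    (e := e a) (by rw [hecard, ha, hι]; exact lt_succ κ)
  obtain ⟨j, hij⟩ := exists_gt i
  have haEi : IsLUB (E i ∩ Iio a) a :=
    ⟨fun b hb ↦ hb.2.le, fun c hc ↦
      haE.2 (upperBounds_mono_set (inter_subset_inter_left _ (iInter_subset E i)) hc)⟩
  refine hnot (E i) ⟨a, ha, subset_inter ?_ (clubGlue_subset_Iio (hea a)),
    isLUB_clubGlue (hclub i).dirSupClosed haEi (hea a) (he a),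
    (mk_clubGlue_le _ _).trans_eq ((hecard a).trans ha)⟩
  exact hi.trans ((iInter_subset E j).trans (hED i j hij))

end ClubGuessing

section Approachability

/-- A small set witnessing that the ordinal `d` is approachable along `P`. It is a cofinal subset
`x` of `d` with fewer than `μ` elements, every initial segment of which cut at a point of `x` is
listed in `P` before stage `d`. -/
structure IsApproachedBy (μ : Cardinal.{u}) (P : Ordinal.{u} → Set (Set Ordinal.{u}))
    (d : Ordinal.{u}) (x : Set Ordinal.{u}) : Prop where
  subset_Iio : x ⊆ Iio d
  mk_lt : #x < lift.{u + 1} μ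
  isLUB : IsLUB x d
  inter_Iio_mem : ∀ b ∈ x, ∃ γ < d, x ∩ Iio b ∈ P γ

theorem IsApproachedBy.inter_Iio_mem_of_lt {μ : Cardinal.{u}}
    {P : Ordinal.{u} → Set (Set Ordinal.{u})} {d ζ : Ordinal.{u}} {x : Set Ordinal.{u}}
    (hx : IsApproachedBy μ P d x) (hζ : ζ < d) : ∃ γ < d, x ∩ Iio ζ ∈ P γ := by
  obtain ⟨c, hcx, hζc⟩ := (lt_isLUB_iff hx.isLUB).1 hζ
  obtain ⟨b, ⟨hbx, hζb⟩, hb⟩ := exists_isLeast_of_nonempty (s := x ∩ Ici ζ) ⟨c, hcx, hζc.le⟩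
  obtain ⟨γ, hγ, hmem⟩ := hx.inter_Iio_mem b hbx
  have hinter : x ∩ Iio ζ = x ∩ Iio b := by
    ext y
    simp only [mem_inter_iff, mem_Iio]
    exact and_congr_right fun hy ↦ ⟨fun h ↦ h.trans_le hζb, fun h ↦ not_le.1 fun hζy ↦
      (hb ⟨hy, hζy⟩).not_gt h⟩
  exact ⟨γ, hγ, hinter ▸ hmem⟩

theorem orderTypeOf_lt_lift {μ : Cardinal.{u}} {d : Ordinal.{u}} {x : Set Ordinal.{u}}
    (hx : #x < lift.{u + 1} μ) (hd : μ.ord ≤ d) : orderTypeOf x < Ordinal.lift.{u + 1} d := by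
  refine lt_of_lt_of_le ?_ (Ordinal.lift_le.2 hd)
  rw [lift_ord, lt_ord, orderTypeOf, Ordinal.card_type]
  exact hx

theorem cof_Iio_ord {c : Cardinal.{u}} (hc : c.IsRegular) :
    cof (Iio c.ord) = lift.{u + 1} c := by
  rw [Ordinal.cof_Iio, ← Ordinal.lift_cof, hc.cof_ord]

theorem cof_Iio_subtype_Iio {o : Ordinal.{u}} (d : Iio o) :
    cof (Iio d) = lift.{u + 1} (d : Ordinal.{u}).cof := by
  rw [Ordinal.lift_cof, ← Ordinal.cof_Iio]
  refine cof_congr_of_strictMono (f := fun b : Iio d ↦ (⟨b.1, b.2⟩ : Iio (d : Ordinal.{u})))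
    (fun _ _ h ↦ h) fun b ↦ ?_
  exact ⟨b, ⟨⟨⟨b, (mem_Iio.1 b.2).trans d.2⟩, b.2⟩, rfl⟩, le_rfl⟩

theorem exists_stationaryIn_mem_approachabilityIdeal {κ μ lam : Cardinal.{u}} (hκμ : κ ≤ μ)
    (hμ : μ < lam) (hlam : lam.IsRegular) (hlam₀ : ℵ₀ < lam)
    {P : Ordinal.{u} → Set (Set Ordinal.{u})}
    (hP : ∀ a < lam.ord, #(P a) < lift.{u + 1} lam ∧ ∀ y ∈ P a, y ⊆ Iio a)
    (happroached : ∀ E : Set (Iio lam.ord), IsClub E →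
      ∃ d ∈ E, (d : Ordinal.{u}).cof = κ ∧ ∃ x, IsApproachedBy μ P d x) :
    ∃ S : Set Ordinal.{u}, S ⊆ {δ | δ < lam.ord ∧ δ.cof = κ} ∧
      StationaryIn lam.ord S ∧ S ∈ approachabilityIdeal lam := by
  have hcof : ℵ₀ < cof (Iio lam.ord) := by simpa [cof_Iio_ord hlam] using hlam₀
  have := noMaxOrder_of_aleph0_le_cof hcof.le
  let S := {d | d < lam.ord ∧ d.cof = κ ∧ μ.ord < d ∧ ∃ x, IsApproachedBy μ P d x}
  have hsingular : {δ | δ ∈ S ∧ δ = δ.cof.ord} = ∅ := by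
    refine eq_empty_of_forall_notMem fun d ⟨⟨_, hd, hμd, _⟩, hreg⟩ ↦ hμd.not_ge ?_
    rw [hreg, hd]
    exact ord_mono hκμ
  refine ⟨S, fun d hd ↦ ⟨hd.1, hd.2.1⟩, fun E hE ↦ ?_, fun d hd ↦ hd.1, ?_, P, hP, ?_⟩
  · obtain ⟨d, ⟨hdE, hμd⟩, hd, hx⟩ := happroached _
      (hE.inter hcof.ne' (isClub_Ioi ⟨μ.ord, ord_lt_ord.2 hμ⟩))
    exact ⟨d, ⟨d.2, hd, hμd, hx⟩, hdE⟩
  · intro hstat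
    obtain ⟨d, hd⟩ := hstat.nonempty
    exact (hsingular ▸ hd : (d : Ordinal.{u}) ∈ (∅ : Set Ordinal.{u}))
  · rintro d ⟨-, -, hμd, x, hx⟩ - -
    exact ⟨x, hx.subset_Iio, orderTypeOf_lt_lift hx.mk_lt hμd.le, hx.isLUB,
      fun ζ ↦ hx.inter_Iio_mem_of_lt⟩

end Approachability

section Successor

theorem exists_isClub_forall_lt_iff_lt {α : Type u} [LinearOrder α] [WellFoundedLT α]
    [IsRegularCardinalOrder α] (hα : ℵ₀ < cof α) {γ : Type v} [Preorder γ] {g : γ → γ → α} {d : γ}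
    (hg : ∀ b ≤ d, InjOn (g b) (Iio b)) :
    ∃ D : Set α, IsClub D ∧
      ∀ i ∈ D, ∀ b < d, g d b < i → ∀ a < b, (g b a < i ↔ g d a < i) := by
  have : Nonempty γ := ⟨d⟩
  let inv (b : γ) : α → γ := Function.invFunOn (g b) (Iio b)
  have hinv {b a : γ} (hb : b ≤ d) (ha : a < b) : inv b (g b a) = a :=
    (hg b hb).leftInvOn_invFunOn ha
  refine ⟨_, (isClub_setOf_forall_lt_forall_lt_apply_lt hα fun j k ↦
    g d (inv (inv d j) k)).inter hα.ne' (isClub_setOf_forall_lt_forall_lt_apply_lt hα fun j k ↦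
    g (inv d j) (inv d k)), fun i hi b hb hbi a hab ↦ ⟨fun h ↦ ?_, fun h ↦ ?_⟩⟩
  · simpa only [hinv le_rfl hb, hinv hb.le hab] using hi.1 _ hbi _ h
  · simpa only [hinv le_rfl hb, hinv le_rfl (hab.trans hb)] using hi.2 _ hbi _ h

theorem exists_injOn_of_lift_mk_le {α : Type u} {γ : Type v} [Nonempty α] {s : Set γ}
    (hs : lift.{u} #s ≤ lift.{v} #α) : ∃ f : γ → α, InjOn f s :=
  exists_injOn_iff_injective.2 <| (lift_mk_le'.1 hs).elim fun f ↦ ⟨f, f.injective⟩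

/-- The sets enumerated before stage `b` by the injections `g d` of the ordinals `d`: those of the
form `{a < d | g d a < i}` with `d < b`. -/
def sublevelSets {α : Type u} [LT α] (g : Ordinal.{u} → Ordinal.{u} → α) (b : Ordinal.{u}) :
    Set (Set Ordinal.{u}) :=
  {y | ∃ d < b, ∃ i, y = {a | a < d ∧ g d a < i}}

theorem subset_Iio_of_mem_sublevelSets {α : Type u} [LT α] {g : Ordinal.{u} → Ordinal.{u} → α}
    {b : Ordinal.{u}} {y : Set Ordinal.{u}} (hy : y ∈ sublevelSets g b) : y ⊆ Iio b := by
  obtain ⟨d, hdb, i, rfl⟩ := hy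
  exact fun a ha ↦ ha.1.trans hdb

theorem mk_sublevelSets_lt {α : Type u} [LT α] {g : Ordinal.{u} → Ordinal.{u} → α}
    {lam : Cardinal.{u}} (hlam : ℵ₀ ≤ lam) (hα : #α < lam) {b : Ordinal.{u}} (hb : b < lam.ord) :
    #(sublevelSets g b) < lift.{u + 1} lam := by
  have hsub : sublevelSets g b ⊆
      range fun p : Iio b × α ↦ {a | a < (p.1 : Ordinal.{u}) ∧ g p.1 a < p.2} := by
    rintro _ ⟨d, hdb, i, rfl⟩
    exact ⟨(⟨d, hdb⟩, i), rfl⟩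
  refine ((mk_le_mk_of_subset hsub).trans mk_range_le).trans_lt ?_
  rw [mk_prod, lift_id'.{u, u + 1}, mk_Iio_ordinal, ← lift_mul, lift_lt]
  exact mul_lt_of_lt hlam (lt_ord.1 hb) hα

theorem exists_isApproachedBy_sublevelSets {κ μ : Cardinal.{u}} (hκ : κ.IsRegular)
    (hμ : μ.IsRegular) (hκμ : κ < μ) {g : Ordinal.{u} → Ordinal.{u} → μ.ord.ToType}
    {d : Ordinal.{u}} (hg : ∀ b ≤ d, InjOn (g b) (Iio b)) (hd : d.cof = κ) :
    ∃ x, IsApproachedBy μ (sublevelSets g) d x := by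
  have := isRegularCardinalOrder_toType_ord hμ
  have hcof := cof_toType_ord hμ
  have hlim : IsSuccLimit d := Ordinal.one_lt_cof_iff.1 (hd ▸ one_lt_aleph0.trans_le hκ.aleph0_le)
  obtain ⟨D, hD, hcoh⟩ := exists_isClub_forall_lt_iff_lt
    (hcof.symm ▸ hκ.aleph0_le.trans_lt hκμ) hg
  obtain ⟨e, hed, hecard, he⟩ := exists_subset_Iio_mk_eq_cof_Iio d
  obtain ⟨i₀, hi₀⟩ := exists_forall_lt_of_lift_mk_lt_lift_cof (fun y : e ↦ g d y)
    (by rw [hecard, Ordinal.cof_Iio, ← Ordinal.lift_cof, hd, hcof]; simpa using hκμ)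
  obtain ⟨i, hiD, hi₀i⟩ := hD.isCofinal i₀
  refine ⟨{a | a < d ∧ g d a < i}, fun a ha ↦ ha.1, ?_, ⟨fun a ha ↦ ha.1.le, fun c hc ↦ ?_⟩, ?_⟩
  · have hinj : InjOn (g d) {a | a < d ∧ g d a < i} := (hg d le_rfl).mono fun a ha ↦ ha.1
    rw [← lift_id'.{u, u + 1} #_, ← mk_image_eq_of_injOn_lift _ _ hinj, lift_lt]
    refine lt_of_lt_of_eq ?_ hcof
    exact (mk_le_mk_of_subset (image_subset_iff.2 fun a ha ↦ ha.2)).trans_lt (mk_Iio_lt_cof i)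
  · by_contra! hcd
    obtain ⟨y, hye, hcy⟩ := he _ (hlim.succ_lt hcd)
    exact (succ_le_iff.1 hcy).not_ge (hc ⟨hed hye, (hi₀ ⟨y, hye⟩).trans_le hi₀i⟩)
  · rintro b ⟨hbd, hbi⟩
    refine ⟨succ b, hlim.succ_lt hbd, b, lt_succ b, i, ?_⟩
    ext a
    constructor
    · rintro ⟨⟨-, hai⟩, hab⟩
      exact ⟨hab, (hcoh i hiD b hbd hbi a hab).2 hai⟩
    · rintro ⟨hab, hai⟩
      exact ⟨⟨hab.trans hbd, (hcoh i hiD b hbd hbi a hab).1 hai⟩, hab⟩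

theorem exists_stationaryIn_mem_approachabilityIdeal_succ {κ μ : Cardinal.{u}} (hκ : κ.IsRegular)
    (hμ : μ.IsRegular) (hκμ : κ < μ) :
    ∃ S : Set Ordinal.{u}, S ⊆ {δ | δ < (succ μ).ord ∧ δ.cof = κ} ∧
      StationaryIn (succ μ).ord S ∧ S ∈ approachabilityIdeal (succ μ) := by
  have hsucc := isRegular_succ hμ.aleph0_le
  have := nonempty_of_aleph0_le_cof (hμ.aleph0_le.trans_eq (cof_toType_ord hμ).symm)
  have hinj : ∀ d < (succ μ).ord, ∃ f : Ordinal.{u} → μ.ord.ToType, InjOn f (Iio d) :=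
    fun d hd ↦ exists_injOn_of_lift_mk_le <| by
      simpa only [mk_Iio_ordinal, mk_ord_toType, lift_lift, lift_le] using
        lt_succ_iff.1 (lt_ord.1 hd)
  choose! g hg using hinj
  refine exists_stationaryIn_mem_approachabilityIdeal (P := sublevelSets g) hκμ.le (lt_succ μ)
    hsucc (hμ.aleph0_le.trans_lt (lt_succ μ)) (fun b hb ↦ ⟨mk_sublevelSets_lt hsucc.aleph0_le
      (by simp) hb, fun _ ↦ subset_Iio_of_mem_sublevelSets⟩) fun E hE ↦ ?_
  obtain ⟨d, hdE, hd, -⟩ := exists_lift_cof_Iio_eq_and_isLUB_inter hκ hE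
    (by simpa [cof_Iio_ord hsucc] using hκμ.trans (lt_succ μ))
  have hdκ : (d : Ordinal.{u}).cof = κ := by
    simpa only [cof_Iio_subtype_Iio, lift_lift, lift_inj] using hd
  exact ⟨d, hdE, hdκ,
    exists_isApproachedBy_sublevelSets hκ hμ hκμ (fun b hb ↦ hg b (hb.trans_lt d.2)) hdκ⟩

end Successor

section Guessing

variable {α : Type u} [LinearOrder α]

/-- The sets available before stage `b` from the guesses `C a` and the enumerations `e d` of cofinal
subsets of the ordinals `d`: those of the form `e d '' (C a ∩ Iio i)` with `d < b` that are bounded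
by `b`. -/
def guessedSets (C : α → Set α) (e : Ordinal.{u} → α → Ordinal.{u}) (b : Ordinal.{u}) :
    Set (Set Ordinal.{u}) :=
  {y | y ⊆ Iio b ∧ ∃ d < b, ∃ a i, y = e d '' (C a ∩ Iio i)}

theorem mk_guessedSets_lt {C : α → Set α} {e : Ordinal.{u} → α → Ordinal.{u}}
    {lam : Cardinal.{u}} (hlam : ℵ₀ ≤ lam) (hα : #α < lam) {b : Ordinal.{u}} (hb : b < lam.ord) :
    #(guessedSets C e b) < lift.{u + 1} lam := by
  have hsub : guessedSets C e b ⊆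
      range fun p : Iio b × α × α ↦ e p.1 '' (C p.2.1 ∩ Iio p.2.2) := by
    rintro _ ⟨-, d, hdb, a, i, rfl⟩
    exact ⟨(⟨d, hdb⟩, a, i), rfl⟩
  refine ((mk_le_mk_of_subset hsub).trans mk_range_le).trans_lt ?_
  rw [mk_prod, lift_id'.{u, u + 1}, mk_Iio_ordinal, ← lift_mul, lift_lt, mk_prod, lift_id]
  exact mul_lt_of_lt hlam (lt_ord.1 hb) (mul_lt_of_lt hlam hα hα)

theorem cof_apply_eq_cof_Iio {f : α → Ordinal.{u}} (hf : IsNormal f) {a : α}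
    (ha : IsSuccLimit a) : (f a).cof = cof (Iio a) := by
  have := ha.isSuccPrelimit.noMaxOrder_Iio
  have hlub := hf.isLUB_image_Iio_of_isSuccLimit ha
  rw [image_eq_range] at hlub
  have h := lift_cof_Iio_of_isLUB_range (α := Iio a) (fun _ _ h ↦ hf.strictMono h) hlub
  rw [Ordinal.cof_Iio, ← Ordinal.lift_cof] at h
  simpa only [lift_lift, lift_inj] using h

variable [WellFoundedLT α]

theorem exists_isNormal_isLUB_and_image_mem_guessedSets {lam : Cardinal.{u}}
    (hlam : lam.IsRegular) (hα : #α < lam) (C : α → Set α) (e : Ordinal.{u} → α → Ordinal.{u})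
    {E : Set (Iio lam.ord)} (hE : IsClub E) :
    ∃ (f : α → Iio lam.ord) (d : Ordinal.{u}), IsNormal (fun i ↦ (f i : Ordinal.{u})) ∧
      IsLUB (range fun i ↦ (f i : Ordinal.{u})) d ∧ (∀ i, f i ∈ E) ∧
      ∀ a i j, i < j → (fun i ↦ (f i : Ordinal.{u})) '' (C a ∩ Iio i) = e d '' (C a ∩ Iio i) →
        ∃ γ < (f j : Ordinal.{u}),
          (fun i ↦ (f i : Ordinal.{u})) '' (C a ∩ Iio i) ∈ guessedSets C e γ := by
  have hα' : lift.{u + 1} #α < lift.{u} (cof (Iio lam.ord)) := by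
    simpa [cof_Iio_ord hlam] using hα
  have : Nonempty (Iio lam.ord) := nonempty_of_aleph0_le_cof <| by
    simpa [cof_Iio_ord hlam] using hlam.aleph0_le
  choose! stage hstage using fun (y : Set (Iio lam.ord))
    (hy : ∃ γ : Iio lam.ord, (↑) '' y ∈ guessedSets C e γ) ↦ hy
  obtain ⟨f, hf, hfE, hlt⟩ := exists_isNormal_forall_mem_and_image_lt hE hα' C stage
  obtain ⟨b, hb⟩ := exists_forall_lt_of_lift_mk_lt_lift_cof f hα'
  have hbdd : (b : Ordinal.{u}) ∈ upperBounds (range fun i ↦ (f i : Ordinal.{u})) :=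
    forall_mem_range.2 fun i ↦ (hb i).le
  obtain ⟨d, hd⟩ := exists_isLUB_of_bddAbove ⟨_, hbdd⟩
  have hdlam : succ d < lam.ord :=
    (isSuccLimit_ord hlam.aleph0_le).succ_lt ((hd.2 hbdd).trans_lt b.2)
  refine ⟨f, d, (PrincipalSeg.isNormal (principalSegIio lam.ord)).comp hf, hd, hfE,
    fun a i j hij heq ↦ ⟨stage (f '' (C a ∩ Iio i)), hlt a i j hij, ?_⟩⟩
  have hmem := hstage (f '' (C a ∩ Iio i)) ⟨⟨succ d, hdlam⟩, ?_⟩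
  · rwa [image_image] at hmem
  · rw [image_image]
    refine ⟨?_, d, lt_succ d, a, i, heq⟩
    rintro _ ⟨k, -, rfl⟩
    exact lt_succ_of_le (hd.1 ⟨k, rfl⟩)

variable [IsRegularCardinalOrder α]

theorem IsClubGuessing.exists_isApproachedBy {κ : Cardinal.{u}} (hκ : κ.IsRegular)
    {C : α → Set α} (hC : IsClubGuessing κ C) (hα : ℵ₀ < cof α) {f g : α → Ordinal.{u}}
    (hf : IsNormal f) (hg : IsNormal g) {d : Ordinal.{u}} (hfd : IsLUB (range f) d)
    (hgd : IsLUB (range g) d) {P : Ordinal.{u} → Set (Set Ordinal.{u})}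
    (hP : ∀ a i j, i < j → f '' (C a ∩ Iio i) = g '' (C a ∩ Iio i) →
      ∃ γ < f j, f '' (C a ∩ Iio i) ∈ P γ) :
    ∃ a, (f a).cof = κ ∧ ∃ x, IsApproachedBy (succ κ) P (f a) x := by
  obtain ⟨D, hD, hfg⟩ := exists_isClub_eqOn_of_isLUB_range hα hf hg hfd hgd
  obtain ⟨a, ha, hCa, hlub, hcard⟩ := hC D hD
  have hne : (C a).Nonempty := by
    obtain ⟨b⟩ := nonempty_of_aleph0_le_cof (ha ▸ hκ.aleph0_le)
    exact ((lt_isLUB_iff hlub).1 b.2).imp fun _ h ↦ h.1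
  have hlim := hlub.isSuccLimit_of_notMem hne fun h ↦ (hCa h).2.false
  refine ⟨a, (cof_apply_eq_cof_Iio hf hlim).trans ha, f '' C a, ?_, ?_,
    hf.map_isLUB hlub hne, ?_⟩
  · rintro _ ⟨i, hi, rfl⟩
    exact hf.strictMono (hCa hi).2
  · have := mk_image_le_lift (f := f) (s := C a)
    rw [lift_id'.{u, u + 1}] at this
    exact this.trans_lt (lift_lt.2 (lt_succ_iff.2 hcard))
  · rintro _ ⟨i, hi, rfl⟩
    have hinter : f '' C a ∩ Iio (f i) = f '' (C a ∩ Iio i) := by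
      have hpre : f ⁻¹' Iio (f i) = Iio i := ext fun k ↦ hf.strictMono.lt_iff_lt
      rw [← image_inter_preimage, hpre]
    rw [hinter]
    exact hP a i a (hCa hi).2 (hfg.mono fun k hk ↦ (hCa hk.1).1).image_eq

theorem exists_stationaryIn_mem_approachabilityIdeal_of_lt {κ σ lam : Cardinal.{u}}
    (hκ : κ.IsRegular) (hσ : σ.IsRegular) (hlam : lam.IsRegular) (hκσ : succ κ < σ)
    (hσlam : σ < lam) :
    ∃ S : Set Ordinal.{u}, S ⊆ {δ | δ < lam.ord ∧ δ.cof = κ} ∧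
      StationaryIn lam.ord S ∧ S ∈ approachabilityIdeal lam := by
  have := isRegularCardinalOrder_toType_ord hσ
  have hcof := cof_toType_ord hσ
  have hlam₀ := hσ.aleph0_le.trans_lt hσlam
  have hσ₀ := hκ.aleph0_le.trans_lt ((lt_succ κ).trans hκσ)
  obtain ⟨C, hC⟩ := exists_isClubGuessing (α := σ.ord.ToType) hκ (hκσ.trans_eq hcof.symm)
  choose! e he hed using fun d (h : ∃ f : σ.ord.ToType → Ordinal.{u},
    IsNormal f ∧ IsLUB (range f) d) ↦ h
  refine exists_stationaryIn_mem_approachabilityIdeal (P := guessedSets C e) (le_succ κ)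
    (hκσ.trans hσlam) hlam hlam₀ (fun b hb ↦ ⟨mk_guessedSets_lt hlam₀.le (by simpa) hb,
      fun _ hy ↦ hy.1⟩) fun E hE ↦ ?_
  obtain ⟨f, d, hf, hd, hfE, hmem⟩ :=
    exists_isNormal_isLUB_and_image_mem_guessedSets hlam (by simpa) C e hE
  obtain ⟨a, ha, hx⟩ := hC.exists_isApproachedBy hκ (hcof.symm ▸ hσ₀) hf (he d ⟨_, hf, hd⟩) hd
    (hed d ⟨_, hf, hd⟩) hmem
  exact ⟨f a, hfE a, ha, hx⟩

end Guessing

theorem mainTheorem2 (κ lam : Cardinal.{u}) (hκ : κ.IsRegular) (hlam : lam.IsRegular)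
    (h : Order.succ κ < lam) :
    ∃ S : Set Ordinal.{u}, S ⊆ {δ | δ < lam.ord ∧ δ.cof = κ} ∧
      StationaryIn lam.ord S ∧ S ∈ approachabilityIdeal lam := by
  have hsucc := isRegular_succ hκ.aleph0_le
  rcases (succ_le_of_lt h).eq_or_lt with rfl | hlt
  · exact exists_stationaryIn_mem_approachabilityIdeal_succ hκ hsucc (lt_succ κ)
  · exact exists_stationaryIn_mem_approachabilityIdeal_of_lt hκ (isRegular_succ hsucc.aleph0_le)
      hlam (lt_succ (succ κ)) hlt
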